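/- A sequence $\underline a=(a_0,a_1,\dots)$ of complex numbers of period $N$ (i.e. $a_{i+N}=a_i$ for all $i\ge 0$) is called *almost $p$-ary*, for a prime $p$, if $a_0=0$ and, for some primitive $p$-th root of unity $\zeta_p\in\mathbb C$, each of $a_1,\dots,a_{N-1}$ is a power of $\zeta_p$. It is called *perfect* if $\sum_{i=0}^{N-1}a_i\overline{a_{i+t}}=0$ for all $1\le t\le N-1$. An $(m,p,k,\lambda)$-*relative difference set* in $\mathbb Z_m\times\mathbb Z_p$ relative to $\{0\}\times\mathbb Z_p$ is a subset $R\subseteq\mathbb Z_m\times\mathbb Z_p$ with $|R|=k$ such that every element of $(\mathbb Z_m\times\mathbb Z_p)\setminus(\{0\}\times\mathbb Z_p)$ is represented exactly $\lambda$ times as a difference $r_1-r_2$ with $r_1,r_2\in R$, and no nonzero element of $\{0\}\times\mathbb Z_p$ is represented. **Theorem.** Let $(n,p)\in\{(63,31),(91,3),(92,7),(93,23)\}$. Then there is no almost $p$-ary perfect sequence of period $n+1$, and there is no $(n+1,p,n,\frac{n-1}{p})$-relative difference set in $\mathbb Z_{n+1}\times\mathbb Z_p$ relative to $\{0\}\times\mathbb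 Z_p$. -/

import Mathlib

/-- The periodic autocorrelation `C_a(t) = ∑_{i=0}^{N-1} a_i * conj (a_{i+t})` of a sequence
of period `N`. -/
noncomputable def autocorrelation (N : ℕ) (a : ℕ → ℂ) (t : ℕ) : ℂ :=
  ∑ i ∈ Finset.range N, a i * (starRingEnd ℂ) (a (i + t))

/-- An almost `p`-ary sequence of period `N`: it is `N`-periodic, `a_0 = 0`, and the other entries
`a_1, ..., a_{N-1}` of the period are powers of a primitive `p`-th root of unity. -/
def IsAlmostPAry (p N : ℕ) (a : ℕ → ℂ) : Prop :=
  Function.Periodic a N ∧ a 0 = 0 ∧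
    ∃ ζ : ℂ, IsPrimitiveRoot ζ p ∧ ∀ i : ℕ, 1 ≤ i → i < N → ∃ b : ℤ, a i = ζ ^ b

/-- A sequence of period `N` is perfect if all its out-of-phase autocorrelation coefficients
are zero. -/
def IsPerfectSeq (N : ℕ) (a : ℕ → ℂ) : Prop :=
  ∀ t : ℕ, 1 ≤ t → t < N → autocorrelation N a t = 0

/-- The number of ways to write `g` as a difference `r₁ - r₂` with `r₁, r₂ ∈ R`. -/
def diffCount {G : Type*} [AddGroup G] [DecidableEq G] (R : Finset G) (g : G) : ℕ :=
  ((R ×ˢ R).filter (fun r => r.1 - r.2 = g)).card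

/-- An `(m, n, k, l₁, l₂, μ)` direct product difference set in `H × N` relative to `H` and `N`
(additive notation). -/
structure IsDPDS {H N : Type*} [AddGroup H] [AddGroup N] [DecidableEq H] [DecidableEq N]
    (m n k l₁ l₂ μ : ℕ) (R : Finset (H × N)) : Prop where
  card_left : Nat.card H = m
  card_right : Nat.card N = n
  card_eq : R.card = k
  diff_left : ∀ h : H, h ≠ 0 → diffCount R (h, 0) = l₁
  diff_right : ∀ x : N, x ≠ 0 → diffCount R (0, x) = l₂
  diff_other : ∀ (h : H) (x : N), h ≠ 0 → x ≠ 0 → diffCount R (h, x) = μ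

/-- An `(m, n, k, l)` relative difference set in `H × N` relative to `N`. -/
def IsRDS {H N : Type*} [AddGroup H] [AddGroup N] [DecidableEq H] [DecidableEq N]
    (m n k l : ℕ) (R : Finset (H × N)) : Prop :=
  IsDPDS m n k l 0 l R

set_option linter.unusedSectionVars false

/-! Both objects yield a map `b` with `IsPerfectMap b l`, `l = (n-1)/p`; its value at `0` plays no
role. In the group ring let D be the graph of `b` over the nonzero elements, E the sum of everything
outside {0} × K, and D^(t) the image of D under multiplication by t, so that D D^(-1) = n + lE.

The engine is a multiplier theorem, `exists_multiplier`. Put F = D^(t) D^(-1) - lE. If t acts as a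
power of an odd prime q dividing n, then q divides F by Frobenius. If the coefficients of F are
divisible by some d > l, they are nonnegative; together with F F* = n², where * is negation of group
elements, this makes F a multiple of a single group element, whence b(tx) = t b(x) + c for x ≠ 0.

For three of the pairs a prime t > l divides n. After recentring, b is scaled by t, and iterating k
times with t^k = 1 mod n+1 but not mod p forces b to be constant (`not_isPerfectMap_of_prime`).

For (91, 3) neither prime factor exceeds l = 30, but 13 is also a power of 7 modulo 92 and 3, so d =
91 works. Then b is invariant under 13, and counting over the orbits of 13 on ZMod 23 gives a
contradiction (`not_isPerfectMap_of_invariant`). -/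

open Finset in
/-- A map `b : H → K` whose restriction to `H \ {0}` has a graph with `l` representations of each
`(h, k)` with `h ≠ 0` as a difference. -/
def IsPerfectMap {H K : Type*} [AddCommGroup H] [AddCommGroup K] [Fintype H] [DecidableEq H]
    [DecidableEq K] (b : H → K) (l : ℕ) : Prop :=
  ∀ h : H, h ≠ 0 → ∀ k : K,
    #{z : H × H | z.1 ≠ 0 ∧ z.2 ≠ 0 ∧ z.1 - z.2 = h ∧ b z.1 - b z.2 = k} = l

namespace PerfectMap

open Finset

/-! ### The multiplier theorem in the integral group ring -/

section GroupRing

open AddMonoidAlgebra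

variable {H K : Type*} [AddCommGroup H] [AddCommGroup K] [Fintype H] [Fintype K]
  [DecidableEq H] [DecidableEq K]

/-- The image under multiplication by `t` of the graph of `b` over the nonzero elements, as an
element of the group ring. -/
noncomputable def graphSum (S : Type*) [CommRing S] (b : H → K) (t : ℤ) :
    AddMonoidAlgebra S (H × K) :=
  ∑ x : H with x ≠ 0, single (t • x, t • b x) 1

/-- The sum of the elements of `{0} × K` in the group ring. -/
noncomputable def fiberSum (S H K : Type*) [CommRing S] [AddCommGroup H] [AddCommGroup K]
    [Fintype K] : AddMonoidAlgebra S (H × K) :=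
  ∑ k : K, single ((0 : H), k) 1

/-- The sum of the elements outside `{0} × K` in the group ring. -/
noncomputable def offFiberSum (S H K : Type*) [CommRing S] [AddCommGroup H] [AddCommGroup K]
    [Fintype H] [Fintype K] [DecidableEq H] : AddMonoidAlgebra S (H × K) :=
  ∑ h : H with h ≠ 0, ∑ k : K, single (h, k) 1

section

variable (S : Type*) [CommRing S]

lemma card_ne_zero_filter {n : ℕ} (hn : Fintype.card H = n + 1) : #{x : H | x ≠ 0} = n := by
  have h : ({x : H | x ≠ 0} : Finset H) = univ.erase 0 := by ext; simp
  rw [h, card_erase_of_mem (mem_univ _), card_univ, hn, Nat.add_sub_cancel]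

lemma offFiberSum_add_fiberSum :
    offFiberSum S H K + fiberSum S H K = ∑ g : H × K, single g 1 := by
  rw [Fintype.sum_prod_type, ← sum_filter_add_sum_filter_not univ (fun h : H => h ≠ 0)]
  congr 1
  simp only [not_not, filter_eq', mem_univ, if_true, sum_singleton, fiberSum]

lemma single_mul_sum_single {S : Type*} [CommRing S] (g : H × K) :
    single g (1 : S) * ∑ g' : H × K, single g' 1 = ∑ g' : H × K, single g' 1 := by
  rw [mul_sum]
  simp only [single_mul_single, mul_one]
  exact Fintype.sum_equiv (Equiv.addLeft g) _ _ fun _ => rfl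

lemma graphSum_mul_total {n : ℕ} (hn : Fintype.card H = n + 1) (b : H → K) (t : ℤ) :
    graphSum S b t * (offFiberSum S H K + fiberSum S H K) =
      n * (offFiberSum S H K + fiberSum S H K) := by
  rw [offFiberSum_add_fiberSum, graphSum, sum_mul]
  simp only [single_mul_sum_single, sum_const, card_ne_zero_filter hn, nsmul_eq_mul]

lemma single_mul_fiberSum {S : Type*} [CommRing S] (h : H) (k : K) :
    single (h, k) (1 : S) * fiberSum S H K = ∑ k : K, single (h, k) 1 := by
  rw [fiberSum, mul_sum]
  simp only [single_mul_single, mul_one]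
  exact Fintype.sum_equiv (Equiv.addLeft k) _ _ fun _ => by simp

lemma graphSum_mul_fiberSum (b : H → K) {t : ℤ} (ht : Function.Bijective fun x : H => t • x) :
    graphSum S b t * fiberSum S H K = offFiberSum S H K := by
  rw [graphSum, sum_mul, offFiberSum]
  simp only [single_mul_fiberSum]
  refine sum_bijective _ ht (fun x => ?_) fun _ _ => rfl
  have : t • x = 0 ↔ x = 0 := ht.injective.eq_iff' (smul_zero t)
  simp [this]

lemma offFiberSum_mul_fiberSum :
    offFiberSum S H K * fiberSum S H K = Fintype.card K * offFiberSum S H K := by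
  rw [offFiberSum, sum_mul, mul_sum]
  refine sum_congr rfl fun h _ => ?_
  simp only [sum_mul, single_mul_fiberSum, sum_const, card_univ, nsmul_eq_mul]

lemma offFiberSum_mul_total {n : ℕ} (hn : Fintype.card H = n + 1) :
    offFiberSum S H K * (offFiberSum S H K + fiberSum S H K) =
      (n * Fintype.card K : ℕ) * (offFiberSum S H K + fiberSum S H K) := by
  rw [offFiberSum_add_fiberSum, offFiberSum, sum_mul]
  simp only [sum_mul, single_mul_sum_single, sum_const, card_ne_zero_filter hn, nsmul_eq_mul,
    card_univ]
  push_cast; ring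

lemma graphSum_mul_graphSum_neg {n l : ℕ} (hn : Fintype.card H = n + 1) {b : H → K}
    (hb : IsPerfectMap b l) {t : ℤ} (htH : Function.Bijective fun x : H => t • x)
    (htK : Function.Bijective fun x : K => t • x) :
    graphSum S b t * graphSum S b (-t) = n + l * offFiberSum S H K := by
  have key : graphSum S b t * graphSum S b (-t) =
      ∑ g : H × K, ∑ z : H × H with (z.1 ≠ 0 ∧ z.2 ≠ 0) ∧ (z.1 - z.2, b z.1 - b z.2) = g,
        single (t • g.1, t • g.2) (1 : S) := by
    have h1 : graphSum S b t * graphSum S b (-t) = ∑ z : H × H with z.1 ≠ 0 ∧ z.2 ≠ 0,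
        single (t • (z.1 - z.2), t • (b z.1 - b z.2)) (1 : S) := by
      rw [graphSum, graphSum, sum_mul_sum, ← sum_product']
      refine sum_congr (by ext; simp) fun z _ => ?_
      rw [single_mul_single]
      simp [sub_eq_add_neg]
    rw [h1, ← sum_fiberwise _ (fun z : H × H => (z.1 - z.2, b z.1 - b z.2))]
    refine sum_congr rfl fun g _ => ?_
    rw [filter_filter]
    refine sum_congr rfl fun z hz => ?_
    rw [← (mem_filter.1 hz).2.2]
  rw [key, Fintype.sum_prod_type,
    ← sum_filter_add_sum_filter_not univ (fun h : H => h ≠ 0), add_comm]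
  congr 1
  · simp only [not_not, filter_eq', mem_univ, if_true, sum_singleton, sum_const]
    rw [sum_eq_single 0]
    · have : #{z : H × H | (z.1 ≠ 0 ∧ z.2 ≠ 0) ∧ (z.1 - z.2, b z.1 - b z.2) = (0, 0)} = n := by
        rw [← card_ne_zero_filter hn]
        refine card_bij (fun z _ => z.1) ?_ ?_ ?_
        · intro z hz
          simp at hz ⊢
          exact hz.1.1
        · rintro ⟨x, y⟩ hz ⟨x', y'⟩ hz' h
          simp [sub_eq_zero] at hz hz' h ⊢
          exact ⟨h, hz.2.1 ▸ hz'.2.1 ▸ h⟩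
        · intro x hx
          exact ⟨(x, x), by simpa using hx, rfl⟩
      rw [this]
      simp [smul_zero, nsmul_eq_mul, ← Prod.zero_eq_mk, ← one_def]
    · intro k _ hk
      rw [card_eq_zero.2, zero_smul]
      refine filter_eq_empty_iff.2 fun z _ hz => hk ?_
      have h := Prod.ext_iff.1 hz.2
      simp only [sub_eq_zero] at h
      rw [← h.2, h.1, sub_self]
    · simp
  · rw [offFiberSum, mul_sum]
    refine sum_bijective _ htH (fun x => ?_) fun h hh => ?_
    · have : t • x = 0 ↔ x = 0 := htH.injective.eq_iff' (smul_zero t)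
      simp [this]
    · rw [mul_sum]
      refine sum_bijective _ htK (fun x => by simp) fun k _ => ?_
      have := hb h (by simpa using hh) k
      rw [sum_const, nsmul_eq_mul]
      congr 2
      rw [← this]
      congr 1
      ext z
      simp [and_assoc]

end

/-- The Frobenius congruence, in characteristic `q`. -/
lemma graphSum_mul_eq_of_prime {n l q e : ℕ} (hn : Fintype.card H = n + 1) {b : H → K}
    (hb : IsPerfectMap b l) (hq : q.Prime) (hq2 : Odd q) (hqn : q ∣ n) {t : ℤ}
    (htH : ∀ x : H, t • x = q ^ e • x) (htK : ∀ x : K, t • x = q ^ e • x) :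
    graphSum (ZMod q) b t * graphSum (ZMod q) b (-1) = l * offFiberSum (ZMod q) H K := by
  have : Fact q.Prime := ⟨hq⟩
  have : CharP (AddMonoidAlgebra (ZMod q) (H × K)) q :=
    charP_of_injective_algebraMap (FaithfulSMul.algebraMap_injective (ZMod q) _) q
  have hn0 : (n : AddMonoidAlgebra (ZMod q) (H × K)) = 0 := (CharP.cast_eq_zero_iff _ q n).2 hqn
  have hpow : graphSum (ZMod q) b t = graphSum (ZMod q) b 1 ^ q ^ e := by
    rw [graphSum, graphSum, sum_pow_char_pow]
    refine sum_congr rfl fun x _ => ?_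
    rw [single_pow, one_pow, htH, htK]
    simp
  -- Modulo q, DE = -E, so even powers of D fix E. As q^e is odd, D^(q^e) D^(-1) = D^(2j) (D D^(-1))
  -- = l E, with sign +.
  obtain ⟨j, hj⟩ := hq2.pow (n := e)
  have hmul := graphSum_mul_graphSum_neg (ZMod q) hn hb (t := 1)
    (by simp) (by simp)
  have hDG := graphSum_mul_total (ZMod q) hn b 1
  have hDN := graphSum_mul_fiberSum (ZMod q) b (t := 1) (by simp)
  rw [hn0] at hmul hDG
  set D := graphSum (ZMod q) b 1
  set E := offFiberSum (ZMod q) H K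
  have hDE : D * E = -E := by linear_combination hDG - hDN
  have hD2 : ∀ i : ℕ, D ^ (2 * i) * E = E := by
    intro i
    induction i with
    | zero => simp
    | succ i ih => linear_combination ih + D ^ (2 * i) * (D - 1) * hDE
  rw [hpow, hj]
  linear_combination D ^ (2 * j) * hmul + l * hD2 j

/-- The defect of `t` from being a multiplier. -/
noncomputable def multiplierDefect (b : H → K) (l : ℕ) (t : ℤ) : AddMonoidAlgebra ℤ (H × K) :=
  graphSum ℤ b t * graphSum ℤ b (-1) - l * offFiberSum ℤ H K

lemma mapRingHom_graphSum (S : Type*) [CommRing S] (b : H → K) (t : ℤ) :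
    mapRingHom (H × K) (Int.castRingHom S) (graphSum ℤ b t) = graphSum S b t := by
  simp [graphSum]

lemma mapRingHom_offFiberSum (S : Type*) [CommRing S] :
    mapRingHom (H × K) (Int.castRingHom S) (offFiberSum ℤ H K) = offFiberSum S H K := by
  simp [offFiberSum]

lemma dvd_multiplierDefect {n l q e : ℕ} (hn : Fintype.card H = n + 1) {b : H → K}
    (hb : IsPerfectMap b l) (hq : q.Prime) (hq2 : Odd q) (hqn : q ∣ n) {t : ℤ}
    (htH : ∀ x : H, t • x = q ^ e • x) (htK : ∀ x : K, t • x = q ^ e • x) (g : H × K) :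
    (q : ℤ) ∣ (multiplierDefect b l t).coeff g := by
  rw [← ZMod.intCast_zmod_eq_zero_iff_dvd]
  have h : mapRingHom (H × K) (Int.castRingHom (ZMod q)) (multiplierDefect b l t) = 0 := by
    rw [multiplierDefect, map_sub, map_mul, map_mul, map_natCast, mapRingHom_graphSum,
      mapRingHom_graphSum, mapRingHom_offFiberSum,
      graphSum_mul_eq_of_prime hn hb hq hq2 hqn htH htK, sub_self]
  have := congrArg (fun f => f.coeff g) h
  simpa using this

lemma coeff_graphSum_mul_graphSum (b : H → K) (s t : ℤ) (g : H × K) :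
    0 ≤ (graphSum ℤ b s * graphSum ℤ b t).coeff g := by
  simp only [graphSum, sum_mul_sum, single_mul_single, coeff_sum, Finsupp.finsetSum_apply,
    coeff_single, mul_one]
  exact sum_nonneg fun _ _ => sum_nonneg fun _ _ => by
    rw [Finsupp.single_apply]; split_ifs <;> simp

lemma coeff_offFiberSum_le (g : H × K) : (offFiberSum ℤ H K).coeff g ≤ 1 := by
  have h1 : (offFiberSum ℤ H K + fiberSum ℤ H K).coeff g = 1 := by
    rw [offFiberSum_add_fiberSum]
    simp [Finsupp.single_apply]
  have h2 : 0 ≤ (fiberSum ℤ H K).coeff g := by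
    simp only [fiberSum, coeff_sum, Finsupp.finsetSum_apply, coeff_single]
    exact sum_nonneg fun _ _ => by rw [Finsupp.single_apply]; split_ifs <;> simp
  rw [coeff_add, Finsupp.add_apply] at h1
  lia

/-- The product of graphs has nonnegative coefficients and E has coefficients at most 1, so every
coefficient is at least -l > -d; a multiple of d above -d is nonnegative. -/
lemma multiplierDefect_nonneg {b : H → K} {l d : ℕ} {t : ℤ} (hd : l < d)
    (hdvd : ∀ g, (d : ℤ) ∣ (multiplierDefect b l t).coeff g) (g : H × K) :
    0 ≤ (multiplierDefect b l t).coeff g := by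
  have h1 : -(l : ℤ) ≤ (multiplierDefect b l t).coeff g := by
    have e : (multiplierDefect b l t).coeff g =
        (graphSum ℤ b t * graphSum ℤ b (-1)).coeff g - l * (offFiberSum ℤ H K).coeff g := by
      rw [multiplierDefect, coeff_sub, Finsupp.sub_apply, ← nsmul_eq_mul, coeff_smul]
      simp
    have := coeff_graphSum_mul_graphSum b t (-1) g
    have := mul_le_mul_of_nonneg_left (coeff_offFiberSum_le (H := H) (K := K) g)
      (Int.natCast_nonneg l)
    lia
  obtain ⟨c, hc⟩ := hdvd g
  rw [hc] at h1 ⊢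
  by_contra! h
  have : c < 0 := by
    by_contra! h0
    exact absurd h (not_lt.2 (by positivity))
  nlinarith

/-- Negation on the group ring. -/
noncomputable def conjHom (S H K : Type*) [CommRing S] [AddCommGroup H] [AddCommGroup K] :
    AddMonoidAlgebra S (H × K) →+* AddMonoidAlgebra S (H × K) :=
  mapDomainRingHom S (negAddMonoidHom : H × K →+ H × K)

lemma conjHom_graphSum (b : H → K) (t : ℤ) :
    conjHom ℤ H K (graphSum ℤ b t) = graphSum ℤ b (-t) := by
  simp [conjHom, graphSum]

lemma conjHom_offFiberSum : conjHom ℤ H K (offFiberSum ℤ H K) = offFiberSum ℤ H K := by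
  simp only [offFiberSum, map_sum]
  refine sum_equiv (Equiv.neg H) (by simp) fun h _ => ?_
  exact Fintype.sum_equiv (Equiv.neg K) _ _ fun k => by simp [conjHom]

/-- Expanding, the leading term is (D D^(-1)) (D^(t) D^(-t)) = (n + lE)². The remaining terms reduce
through products with E, and the relation n = l|K| + 1 makes all but n² cancel. -/
lemma multiplierDefect_mul_conj {n l : ℕ} (hn : Fintype.card H = n + 1)
    (hl : n = l * Fintype.card K + 1) {b : H → K} (hb : IsPerfectMap b l) {t : ℤ}
    (htH : Function.Bijective fun x : H => t • x) (htK : Function.Bijective fun x : K => t • x) :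
    multiplierDefect b l t * conjHom ℤ H K (multiplierDefect b l t) = (n : ℤ) ^ 2 := by
  have htH' : Function.Bijective fun x : H => (-t) • x := by
    simpa [Function.comp_def] using (Equiv.neg H).bijective.comp htH
  have hidH : Function.Bijective fun x : H => (1 : ℤ) • x := by simp
  have hidK : Function.Bijective fun x : K => (1 : ℤ) • x := by simp
  have hngH : Function.Bijective fun x : H => (-1 : ℤ) • x := by
    simpa using (Equiv.neg H).bijective
  rw [multiplierDefect, map_sub, map_mul, map_mul, map_natCast, conjHom_graphSum,
    conjHom_graphSum, conjHom_offFiberSum, neg_neg]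
  have m1 := graphSum_mul_graphSum_neg ℤ hn hb hidH hidK
  have m2 := graphSum_mul_graphSum_neg ℤ hn hb htH htK
  have g1 := graphSum_mul_total ℤ hn b 1
  have g2 := graphSum_mul_total ℤ hn b (-1)
  have g3 := graphSum_mul_total ℤ hn b t
  have g4 := graphSum_mul_total ℤ hn b (-t)
  have n1 := graphSum_mul_fiberSum ℤ b hidH
  have n2 := graphSum_mul_fiberSum ℤ b hngH
  have n3 := graphSum_mul_fiberSum ℤ b htH
  have n4 := graphSum_mul_fiberSum ℤ b htH'
  have e1 := offFiberSum_mul_total (K := K) ℤ hn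
  have e2 := offFiberSum_mul_fiberSum ℤ (H := H) (K := K)
  have hl' : (n : AddMonoidAlgebra ℤ (H × K)) = l * Fintype.card K + 1 := by
    exact_mod_cast congrArg (Nat.cast (R := AddMonoidAlgebra ℤ (H × K))) hl
  push_cast at e1 ⊢
  set A := graphSum ℤ b 1
  set A' := graphSum ℤ b (-1)
  set B := graphSum ℤ b t
  set B' := graphSum ℤ b (-t)
  set E := offFiberSum ℤ H K
  set N := fiberSum ℤ H K
  set n' := (n : AddMonoidAlgebra ℤ (H × K))
  set l' := (l : AddMonoidAlgebra ℤ (H × K))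
  set p' := (Fintype.card K : AddMonoidAlgebra ℤ (H × K))
  have a1 : A * E = n' * (E + N) - E := by linear_combination g1 - n1
  have a2 : A' * E = n' * (E + N) - E := by linear_combination g2 - n2
  have a3 : B * E = n' * (E + N) - E := by linear_combination g3 - n3
  have a4 : B' * E = n' * (E + N) - E := by linear_combination g4 - n4
  have ee : E * E = n' * p' * (E + N) - p' * E := by linear_combination e1 - e2
  have c1 : B * A' * E = n' * n' * (E + N) - (n' * (E + N) - E) := by
    linear_combination B * a2 + n' * g3 - a3
  have c2 : B' * A * E = n' * n' * (E + N) - (n' * (E + N) - E) := by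
    linear_combination B' * a1 + n' * g4 - a4
  have c3 : l' * (E * E) = n' * (n' - 1) * (E + N) - (n' - 1) * E := by
    rw [hl']; rw [hl'] at ee; linear_combination l' * ee
  have c4 : B * A' * (B' * A) = (n' + l' * E) ^ 2 := by
    linear_combination B * B' * m1 + (n' + l' * E) * m2
  linear_combination c4 - l' * c1 - l' * c2 + 2 * l' * c3

lemma coeff_mul_conj (F : AddMonoidAlgebra ℤ (H × K)) (g : H × K) :
    (F * conjHom ℤ H K F).coeff g = ∑ a : H × K, F.coeff a * F.coeff (a - g) := by
  have hF : F = ∑ a : H × K, single a (F.coeff a) := by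
    ext a
    simp
  have hG : conjHom ℤ H K F = ∑ a : H × K, single (-a) (F.coeff a) := by
    nth_rewrite 1 [hF]
    simp [conjHom]
  nth_rewrite 1 [hG]
  nth_rewrite 1 [hF]
  simp only [sum_mul_sum, single_mul_single, coeff_sum, Finsupp.finsetSum_apply, coeff_single]
  refine sum_congr rfl fun a _ => ?_
  rw [sum_eq_single (a - g)]
  · simp
  · intro c _ hc
    rw [Finsupp.single_apply, if_neg]
    rintro rfl
    simp at hc
  · simp

/-- Off the identity, each coefficient of F F* is a vanishing sum of nonnegative products F(a) F(a -
g), so two distinct points cannot both lie in the support. -/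
lemma eq_single_of_nonneg_of_mul_conj {c : ℤ} (hc : c ≠ 0) {F : AddMonoidAlgebra ℤ (H × K)}
    (hF : ∀ g, 0 ≤ F.coeff g) (h : F * conjHom ℤ H K F = c) :
    ∃ g, F.coeff g ≠ 0 ∧ F = single g (F.coeff g) := by
  have hcast : (c : AddMonoidAlgebra ℤ (H × K)) = single 0 c := by simp [intCast_def]
  have hne : ∃ g, F.coeff g ≠ 0 := by
    by_contra! h0
    have : F = 0 := by ext a; simpa using h0 a
    rw [this, zero_mul] at h
    exact single_ne_zero.2 hc (hcast.symm.trans h.symm)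
  obtain ⟨g, hg⟩ := hne
  refine ⟨g, hg, ?_⟩
  ext a
  rw [coeff_single, Finsupp.single_apply]
  split_ifs with hga
  · rw [hga]
  have h1 := congrArg (fun f => f.coeff (a - g)) h
  have h2 : ((c : AddMonoidAlgebra ℤ (H × K))).coeff (a - g) = 0 := by
    rw [hcast, coeff_single, Finsupp.single_apply, if_neg]
    exact fun h0 => hga (sub_eq_zero.1 h0.symm).symm
  simp only [coeff_mul_conj, h2] at h1
  have h3 := (sum_eq_zero_iff_of_nonneg fun a' _ => mul_nonneg (hF a') (hF _)).1 h1 a (mem_univ _)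
  rw [sub_sub_cancel] at h3
  exact (mul_eq_zero.1 h3).resolve_right hg

lemma multiplierDefect_mul_graphSum {n l : ℕ} (hn : Fintype.card H = n + 1)
    {b : H → K} (hb : IsPerfectMap b l) {t : ℤ}
    (htH : Function.Bijective fun x : H => t • x) :
    multiplierDefect b l t * graphSum ℤ b 1 = n * graphSum ℤ b t := by
  have m1 := graphSum_mul_graphSum_neg ℤ hn hb (t := 1) (by simp) (by simp)
  have g1 := graphSum_mul_total ℤ hn b 1
  have g3 := graphSum_mul_total ℤ hn b t
  have n1 := graphSum_mul_fiberSum ℤ b (t := 1) (by simp)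
  have n3 := graphSum_mul_fiberSum ℤ b htH
  rw [multiplierDefect]
  linear_combination graphSum ℤ b t * m1 + l * (g3 - n3) - l * (g1 - n1)

/-- The multiplier theorem: `t` maps the graph of `b` over `H \ {0}` to a translate of itself. -/
theorem exists_multiplier {n l d : ℕ} (hn : Fintype.card H = n + 1)
    (hl : n = l * Fintype.card K + 1) {b : H → K} (hb : IsPerfectMap b l) {t : ℤ}
    (htH : Function.Bijective fun x : H => t • x) (htK : Function.Bijective fun x : K => t • x)
    (hd : l < d) (hdvd : ∀ g, (d : ℤ) ∣ (multiplierDefect b l t).coeff g) :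
    ∃ c : K, ∀ x : H, x ≠ 0 → b (t • x) = t • b x + c := by
  have hn0 : (n : ℤ) ^ 2 ≠ 0 := by rw [hl]; positivity
  obtain ⟨g, hg, hF⟩ := eq_single_of_nonneg_of_mul_conj hn0 (multiplierDefect_nonneg hd hdvd)
    (by rw [multiplierDefect_mul_conj hn hl hb htH htK]; push_cast; rfl)
  set c := (multiplierDefect b l t).coeff g
  have hc : 0 < c := lt_of_le_of_ne (multiplierDefect_nonneg hd hdvd g) (Ne.symm hg)
  have key : ∀ x : H, x ≠ 0 → ∃ y : H, y ≠ 0 ∧ t • y = g.1 + x ∧ t • b y = g.2 + b x := by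
    intro x hx
    have h1 := multiplierDefect_mul_graphSum hn hb htH
    rw [hF] at h1
    have h2 := congrArg (fun f => f.coeff (g + (x, b x))) h1
    have h3 : (single g c * graphSum ℤ b 1).coeff (g + (x, b x)) ≠ 0 := by
      simp only [graphSum, mul_sum, single_mul_single, coeff_sum, Finsupp.finsetSum_apply,
        coeff_single, one_smul, mul_one]
      refine ne_of_gt (sum_pos' (fun y _ => ?_) ⟨x, by simpa using hx, ?_⟩)
      · rw [Finsupp.single_apply]; split_ifs <;> simp [hc.le]
      · simpa using hc
    by_contra! hno
    refine h3 (h2.trans ?_)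
    rw [← nsmul_eq_mul, coeff_smul, graphSum]
    simp only [coeff_sum, Finsupp.smul_apply, Finsupp.finsetSum_apply, coeff_single]
    rw [sum_eq_zero, smul_zero]
    intro y hy
    rw [Finsupp.single_apply, if_neg]
    intro h
    have h4 := Prod.ext_iff.1 h
    exact hno y (by simpa using hy) h4.1 h4.2
  -- Both graphs miss exactly the fibre over 0, so the translation cannot move the H-coordinate.
  have hg0 : g.1 = 0 := by
    by_contra h0
    obtain ⟨y, hy, hy1, -⟩ := key (-g.1) (neg_ne_zero.2 h0)
    rw [add_neg_cancel] at hy1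
    exact hy (htH.injective (hy1.trans (smul_zero t).symm))
  refine ⟨-g.2, fun x hx => ?_⟩
  have htx : t • x ≠ 0 := fun h => hx (htH.injective (h.trans (smul_zero t).symm))
  obtain ⟨y, hy, hy1, hy2⟩ := key (t • x) htx
  rw [hg0, zero_add] at hy1
  rw [htH.injective hy1] at hy2
  rw [hy2]; abel

end GroupRing

/-! ### From relative difference sets to perfect maps -/

section RDS

variable {H K : Type*} [AddCommGroup H] [AddCommGroup K] [Fintype H]
  [DecidableEq H] [DecidableEq K]

lemma exists_of_isRDS {n p l : ℕ} (hn : Fintype.card H = n + 1) {R : Finset (H × K)}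
    (hR : IsRDS (n + 1) p n l R) : ∃ b : H → K, IsPerfectMap b l := by
  have hinj : Set.InjOn Prod.fst (R : Set (H × K)) := by
    intro r hr s hs hrs
    by_contra hne
    have hsnd : r.2 - s.2 ≠ 0 := fun h => hne (Prod.ext hrs (sub_eq_zero.1 h))
    have h0 := hR.diff_right _ hsnd
    rw [diffCount, card_eq_zero, filter_eq_empty_iff] at h0
    exact h0 (x := (r, s)) (mem_product.2 ⟨hr, hs⟩) (Prod.ext (sub_eq_zero.2 hrs) rfl)
  have hcard : (R.image Prod.fst).card = n := by rw [card_image_of_injOn hinj, hR.card_eq]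
  -- R projects injectively to H and misses a single point `x₀`; translating `x₀` to 0 turns R into
  -- a graph over H \ {0}.
  have hcompl : ((R.image Prod.fst)ᶜ).card = 1 := by rw [card_compl, hcard, hn]; lia
  obtain ⟨x₀, hx₀⟩ := card_eq_one.1 hcompl
  have hmem : ∀ x : H, x ≠ 0 → ∃ k : K, (x + x₀, k) ∈ R := by
    intro x hx
    have : x + x₀ ∉ (R.image Prod.fst)ᶜ := by rw [hx₀]; simpa using hx
    simpa using this
  have hmem' : ∀ r ∈ R, r.1 - x₀ ≠ 0 := by
    intro r hr h
    have : x₀ ∈ (R.image Prod.fst)ᶜ := by simp [hx₀]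
    rw [mem_compl] at this
    exact this (sub_eq_zero.1 h ▸ mem_image_of_mem _ hr)
  choose! b hb using hmem
  refine ⟨b, fun h hh k => ?_⟩
  have hcount : diffCount R (h, k) = l := by
    by_cases hk : k = 0
    · rw [hk]; exact hR.diff_left h hh
    · exact hR.diff_other h k hh hk
  rw [← hcount, diffCount]
  refine card_bij (fun z _ => ((z.1 + x₀, b z.1), (z.2 + x₀, b z.2))) ?_ ?_ ?_
  · intro z hz
    simp only [mem_filter, mem_univ, true_and] at hz
    simp only [mem_filter, mem_product]
    exact ⟨⟨hb _ hz.1, hb _ hz.2.1⟩, by simp [hz.2.2.1, hz.2.2.2]⟩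
  · intro z _ w _ h
    simp only [Prod.mk.injEq, add_left_inj] at h
    exact Prod.ext h.1.1 h.2.1
  · rintro ⟨r, s⟩ hrs
    simp only [mem_filter, mem_product] at hrs
    have hb' : ∀ r ∈ R, b (r.1 - x₀) = r.2 := by
      intro r hr
      have h1 := hb _ (hmem' r hr)
      rw [sub_add_cancel] at h1
      exact congrArg Prod.snd (hinj h1 hr rfl)
    have h2 := Prod.ext_iff.1 hrs.2
    refine ⟨(r.1 - x₀, s.1 - x₀), ?_, ?_⟩
    · simp only [mem_filter, mem_univ, true_and]
      refine ⟨hmem' r hrs.1.1, hmem' s hrs.1.2, ?_, ?_⟩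
      · rw [sub_sub_sub_cancel_right]; exact h2.1
      · rw [hb' r hrs.1.1, hb' s hrs.1.2]; exact h2.2
    · simp [hb' r hrs.1.1, hb' s hrs.1.2]

end RDS

/-! ### From perfect sequences to perfect maps -/

section Sequence

open Polynomial

/-- A vanishing combination of the `p`-th roots of unity has constant coefficients. -/
lemma coeff_eq_of_sum_primitiveRoot_eq_zero {p : ℕ} [hp : Fact p.Prime] {ζ : ℂ}
    (hζ : IsPrimitiveRoot ζ p) {f : ZMod p → ℚ} (h : ∑ k, (f k : ℂ) * ζ ^ k.val = 0) (k : ZMod p) :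
    f k = f 0 := by
  set P : ℚ[X] := ∑ k : ZMod p, C (f k) * X ^ k.val with hP
  have hcoeff : ∀ k : ZMod p, P.coeff k.val = f k := by
    intro k
    simp only [hP, finsetSum_coeff, coeff_C_mul, coeff_X_pow]
    rw [sum_eq_single k]
    · simp
    · intro j _ hj
      rw [if_neg fun h => hj (ZMod.val_injective p h).symm, mul_zero]
    · simp
  have hroot : aeval ζ P = 0 := by
    simp only [hP, map_sum, map_mul, aeval_C, map_pow, aeval_X]
    exact h
  have hdvd : cyclotomic p ℚ ∣ P := by
    rw [cyclotomic_eq_minpoly_rat hζ hp.out.pos]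
    exact minpoly.dvd ℚ ζ hroot
  obtain ⟨Q, hQ⟩ := hdvd
  have hdeg : P.natDegree ≤ p - 1 := by
    refine natDegree_sum_le_of_forall_le _ _ fun k _ => (natDegree_C_mul_X_pow_le _ _).trans ?_
    have := ZMod.val_lt k
    lia
  -- The cyclotomic polynomial already has degree p - 1, and all its coefficients are 1, so a
  -- constant quotient makes all coefficients of P equal.
  have hQ0 : Q.natDegree = 0 := by
    by_cases h0 : Q = 0
    · simp [h0]
    have := natDegree_mul (cyclotomic_ne_zero p ℚ) h0
    rw [← hQ, natDegree_cyclotomic, Nat.totient_prime hp.out] at this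
    lia
  rw [eq_C_of_natDegree_eq_zero hQ0] at hQ
  have hall : ∀ k : ZMod p, f k = Q.coeff 0 := by
    intro k
    rw [← hcoeff k, hQ, coeff_mul_C, cyclotomic_prime, finsetSum_coeff]
    simp [coeff_X_pow, ZMod.val_lt k]
  rw [hall, hall 0]

lemma zpow_eq_pow_val {p : ℕ} [NeZero p] {ζ : ℂ} (hζ : IsPrimitiveRoot ζ p) (c : ℤ) :
    ζ ^ c = ζ ^ (c : ZMod p).val := by
  have h0 : ζ ≠ 0 := hζ.ne_zero (NeZero.ne p)
  rw [← zpow_natCast ζ (c : ZMod p).val, ZMod.val_intCast]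
  nth_rewrite 1 [← Int.emod_add_mul_ediv c p]
  rw [zpow_add₀ h0, zpow_mul, zpow_natCast, hζ.pow_eq_one, one_zpow, mul_one]

lemma exists_of_sequence {n p l : ℕ} [hp : Fact p.Prime] (hl : n = l * p + 1) {a : ℕ → ℂ}
    (ha : IsAlmostPAry p (n + 1) a) (hperf : IsPerfectSeq (n + 1) a) :
    ∃ b : ZMod (n + 1) → ZMod p, IsPerfectMap b l := by
  obtain ⟨hper, ha0, ζ, hζ, hpow⟩ := ha
  choose! β hβ using hpow
  have hζ0 : ζ ≠ 0 := hζ.ne_zero hp.out.ne_zero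
  set b : ZMod (n + 1) → ZMod p := fun x => (β x.val : ZMod p) with hb
  refine ⟨b, fun h hh k => ?_⟩
  set X : Finset (ZMod (n + 1)) := {x | x ≠ 0 ∧ x - h ≠ 0} with hX
  set cnt : ZMod p → ℕ := fun k => #{x ∈ X | b x - b (x - h) = k} with hcnt
  have hcount : #{z : ZMod (n + 1) × ZMod (n + 1) |
      z.1 ≠ 0 ∧ z.2 ≠ 0 ∧ z.1 - z.2 = h ∧ b z.1 - b z.2 = k} = cnt k := by
    refine card_bij (fun z _ => z.1) ?_ ?_ ?_
    · rintro ⟨x, y⟩ hz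
      simp only [mem_filter, mem_univ, true_and] at hz
      obtain rfl : y = x - h := by rw [← hz.2.2.1]; abel
      simp [hX, hz.1, hz.2.1, hz.2.2.2]
    · rintro ⟨x, y⟩ hz ⟨x', y'⟩ hz' hxx
      simp only [mem_filter, mem_univ, true_and] at hz hz' hxx
      have hyy := hz.2.2.1.trans hz'.2.2.1.symm
      rw [hxx] at hyy ⊢
      rw [sub_right_inj.1 hyy]
    · intro x hx
      simp only [hX, mem_filter, mem_univ, true_and] at hx
      exact ⟨(x, x - h), by simp [hx.1.1, hx.1.2, hx.2], rfl⟩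
  rw [hcount]
  have hval : ∀ x : ZMod (n + 1), x ≠ 0 → a x.val = ζ ^ β x.val := fun x hx =>
    hβ _ (Nat.one_le_iff_ne_zero.2 fun h0 => hx ((ZMod.val_eq_zero x).1 h0)) (ZMod.val_lt x)
  have hterm : ∀ x : ZMod (n + 1), a x.val * (starRingEnd ℂ) (a (x - h).val) =
      if x ≠ 0 ∧ x - h ≠ 0 then ζ ^ (b x - b (x - h)).val else 0 := by
    intro x
    split_ifs with hx
    · rw [hval x hx.1, hval _ hx.2, ← Complex.inv_eq_conj, ← zpow_neg, ← zpow_add₀ hζ0,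
        zpow_eq_pow_val hζ]
      · simp [hb, sub_eq_add_neg]
      · rw [norm_zpow, hζ.norm'_eq_one hp.out.ne_zero, one_zpow]
    · by_cases hx0 : x = 0
      · simp [hx0, ha0]
      · have : x - h = 0 := by
          by_contra h'
          exact hx ⟨hx0, h'⟩
        simp [this, ha0]
  have hsum : ∑ x : ZMod (n + 1), a x.val * (starRingEnd ℂ) (a (x - h).val) = 0 := by
    have hneg : -h ≠ 0 := neg_ne_zero.2 hh
    have h1 := hperf (-h).val (Nat.one_le_iff_ne_zero.2 fun h0 => hneg ((ZMod.val_eq_zero _).1 h0))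
      (ZMod.val_lt _)
    rw [autocorrelation] at h1
    rw [← h1]
    refine sum_bij (fun x _ => x.val) (fun x _ => mem_range.2 (ZMod.val_lt x))
      (fun x _ y _ hxy => ZMod.val_injective _ hxy)
      (fun i hi => ⟨(i : ZMod (n + 1)), mem_univ _, ZMod.val_cast_of_lt (mem_range.1 hi)⟩) ?_
    intro x _
    rw [sub_eq_add_neg, ZMod.val_add, hper.map_mod_nat]
  have hvan : ∑ k, ((cnt k : ℚ) : ℂ) * ζ ^ k.val = 0 := by
    simp only [hterm] at hsum
    rw [← sum_filter, ← sum_fiberwise _ (fun x => b x - b (x - h))] at hsum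
    rw [← hsum]
    refine sum_congr rfl fun k _ => ?_
    rw [sum_congr rfl fun x hx => by rw [(mem_filter.1 hx).2], sum_const, nsmul_eq_mul]
    simp [hcnt, hX]
  have hconst : ∀ k, cnt k = cnt 0 := fun k => by
    exact_mod_cast coeff_eq_of_sum_primitiveRoot_eq_zero hζ (f := fun k => (cnt k : ℚ)) hvan k
  -- Removing 0 and h leaves n - 1 = l p points, spread evenly over the p differences, hence l for
  -- each.
  have hXcard : X.card = l * p := by
    have : X = (univ.erase 0).erase h := by
      ext x
      simp [hX, sub_eq_zero, and_comm]
    rw [this, card_erase_of_mem (by simpa using hh), card_erase_of_mem (mem_univ _), card_univ,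
      ZMod.card]
    lia
  have htot : X.card = ∑ k, cnt k :=
    card_eq_sum_card_fiberwise (f := fun x => b x - b (x - h)) fun _ _ => mem_univ _
  rw [hXcard, sum_congr rfl fun k _ => hconst k, sum_const, card_univ, ZMod.card, smul_eq_mul,
    mul_comm] at htot
  rw [hconst k]
  exact (Nat.eq_of_mul_eq_mul_left hp.out.pos htot).symm

end Sequence

/-! ### Exclusion by a single large prime divisor of n -/

lemma zsmul_bijective_of_coprime {m t : ℕ} (h : t.Coprime m) :
    Function.Bijective fun x : ZMod m => (t : ℤ) • x := by
  have hu : IsUnit (t : ZMod m) := (ZMod.isUnit_iff_coprime t m).2 h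
  convert hu.unit.mulLeft_bijective using 2 with x
  simp

lemma not_const {H K : Type*} [AddCommGroup H] [AddCommGroup K] [Fintype H] [DecidableEq H]
    [DecidableEq K] [Nontrivial H] [Nontrivial K] {b : H → K} {l : ℕ} (hl : 0 < l)
    (hb : IsPerfectMap b l) (c : K) : ∃ x, x ≠ 0 ∧ b x ≠ c := by
  obtain ⟨h, hh⟩ := exists_ne (0 : H)
  obtain ⟨k, hk⟩ := exists_ne (0 : K)
  have h1 := hb h hh k
  obtain ⟨z, hz⟩ := card_pos.1 (h1 ▸ hl)
  simp only [mem_filter, mem_univ, true_and] at hz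
  by_contra! hno
  refine hk ?_
  rw [← hz.2.2.2, hno _ hz.1, hno _ hz.2.1, sub_self]

lemma not_isPerfectMap_of_prime {n p l t k : ℕ} [hp : Fact p.Prime] (hl : n = l * p + 1)
    (hl0 : 0 < l) (ht : t.Prime) (ht2 : Odd t) (htn : t ∣ n) (hlt : l < t)
    (hk : t ^ k ≡ 1 [MOD n + 1]) (hk' : ¬ t ^ k ≡ 1 [MOD p])
    (b : ZMod (n + 1) → ZMod p) : ¬ IsPerfectMap b l := by
  intro hb
  rw [← ZMod.natCast_eq_natCast_iff, Nat.cast_pow, Nat.cast_one] at hk hk'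
  have hcard : Fintype.card (ZMod (n + 1)) = n + 1 := ZMod.card _
  have hnp : p.Coprime n := by rw [hl]; simp
  have : Fact (1 < n + 1) := ⟨by lia⟩
  have htH := zsmul_bijective_of_coprime 
    (Nat.Coprime.coprime_dvd_left htn (by simp : n.Coprime (n + 1)))
  obtain ⟨c, hc⟩ := exists_multiplier hcard (by rw [ZMod.card, hl]) hb
    htH (zsmul_bijective_of_coprime (hnp.symm.coprime_dvd_left htn)) hlt
    (dvd_multiplierDefect (e := 1) hcard hb ht ht2 htn (by simp) (by simp))
  have ht1 : (1 : ZMod p) - t ≠ 0 := fun h => hk' (by rw [← sub_eq_zero.1 h, one_pow])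
  -- The fixed point of y ↦ t y + c; subtracting it makes the multiplier relation linear.
  set c₀ : ZMod p := c / (1 - t) with hc₀
  have hc₀' : c = c₀ - t * c₀ := by rw [hc₀]; field_simp
  have hiter : ∀ j : ℕ, ∀ x : ZMod (n + 1), x ≠ 0 →
      b ((t : ZMod (n + 1)) ^ j * x) - c₀ = (t : ZMod p) ^ j * (b x - c₀) := by
    intro j
    induction j with
    | zero => simp
    | succ j ih =>
      intro x hx
      have htx : (t : ZMod (n + 1)) * x ≠ 0 := by
        intro h
        refine hx (htH.injective ?_)
        simpa using h
      have h1 := hc x hx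
      simp only [zsmul_eq_mul, Int.cast_natCast] at h1
      rw [pow_succ, mul_assoc, ih _ htx, h1, hc₀']
      ring
  obtain ⟨x, hx, hxc⟩ := not_const hl0 hb c₀
  have h2 := hiter k x hx
  rw [hk, one_mul] at h2
  have h3 : ((t : ZMod p) ^ k - 1) * (b x - c₀) = 0 := by linear_combination -h2
  rcases mul_eq_zero.1 h3 with h | h
  · exact hk' (sub_eq_zero.1 h)
  · exact hxc (sub_eq_zero.1 h)

/-- Both sides count pairs of nonzero elements with equal `b`-values whose difference lies over `s`.
-/
lemma sum_card_fiber_mul {H Q K : Type*} [AddCommGroup H] [AddCommGroup Q] [AddCommGroup K]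
    [Fintype H] [Fintype Q] [Fintype K] [DecidableEq H] [DecidableEq Q] [DecidableEq K]
    (f : H →+ Q) (b : H → K) (s : Q) :
    ∑ u, ∑ c, #{x | (x ≠ 0 ∧ f x = u + s) ∧ b x = c} * #{x | (x ≠ 0 ∧ f x = u) ∧ b x = c} =
      ∑ h : H with f h = s,
        #{z : H × H | z.1 ≠ 0 ∧ z.2 ≠ 0 ∧ z.1 - z.2 = h ∧ b z.1 - b z.2 = 0} := by
  set Z : Finset (H × H) := {z | z.1 ≠ 0 ∧ z.2 ≠ 0 ∧
    f (z.1 - z.2) = s ∧ b z.1 - b z.2 = 0} with hZ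
  have h1 : Z.card = ∑ h : H with f h = s,
      #{z : H × H | z.1 ≠ 0 ∧ z.2 ≠ 0 ∧ z.1 - z.2 = h ∧ b z.1 - b z.2 = 0} := by
    rw [card_eq_sum_card_fiberwise (f := fun z => z.1 - z.2)
      (t := ({h : H | f h = s} : Finset (H)))]
    · refine sum_congr rfl fun h hh => ?_
      rw [hZ, filter_filter]
      congr 1
      ext z
      simp only [mem_filter, mem_univ, true_and] at hh ⊢
      constructor
      · rintro ⟨⟨a1, a2, a3, a4⟩, a5⟩
        exact ⟨a1, a2, a5, a4⟩
      · rintro ⟨a1, a2, a3, a4⟩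
        exact ⟨⟨a1, a2, a3 ▸ hh, a4⟩, a3⟩
    · intro z hz
      simp only [hZ, coe_filter, mem_univ, true_and, Set.mem_ofPred_eq] at hz ⊢
      exact hz.2.2.1
  rw [← h1, card_eq_sum_card_fiberwise (f := fun z => (f z.2, b z.2)) (t := univ)
    fun _ _ => mem_univ _, Fintype.sum_prod_type]
  refine sum_congr rfl fun u _ => sum_congr rfl fun c _ => ?_
  rw [← card_product]
  congr 1
  ext z
  simp only [hZ, mem_product, mem_filter, mem_univ, true_and, map_sub, Prod.mk.injEq,
    sub_eq_zero]
  constructor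
  · rintro ⟨⟨⟨a1, a2⟩, a3⟩, ⟨a4, a5⟩, a6⟩
    exact ⟨⟨a1, a4, by rw [a2, a5]; abel, a3.trans a6.symm⟩, a5, a6⟩
  · rintro ⟨⟨a1, a2, a3, a4⟩, a5, a6⟩
    exact ⟨⟨⟨a1, by rw [← a3, ← a5]; abel⟩, a4.trans a6⟩, ⟨a2, a5⟩, a6⟩

/-! ### The pair (91, 3): orbit counting modulo 23 -/

section NinetyOne

/-- The number of nonzero `x` over `u` with `b x = c`. -/
def fiberCount (b : ZMod 92 → ZMod 3) (u : ZMod 23) (c : ZMod 3) : ℕ :=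
  #{x : ZMod 92 | (x ≠ 0 ∧ (x.cast : ZMod 23) = u) ∧ b x = c}

lemma cast_mul_eq (x y : ZMod 92) : ((x * y).cast : ZMod 23) = x.cast * y.cast :=
  ZMod.cast_mul (by norm_num : 23 ∣ 92) x y

lemma sum_fiberCount (b : ZMod 92 → ZMod 3) (u : ZMod 23) :
    ∑ c, fiberCount b u c = #{x : ZMod 92 | x ≠ 0 ∧ (x.cast : ZMod 23) = u} := by
  rw [card_eq_sum_card_fiberwise (f := b) (t := univ) fun _ _ => mem_univ _]
  simp only [filter_filter]
  rfl

lemma sum_fiberCount_mul (b : ZMod 92 → ZMod 3) (s : ZMod 23) :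
    ∑ u, ∑ c, fiberCount b (u + s) c * fiberCount b u c =
      ∑ h : ZMod 92 with (h.cast : ZMod 23) = s,
        #{z : ZMod 92 × ZMod 92 | z.1 ≠ 0 ∧ z.2 ≠ 0 ∧ z.1 - z.2 = h ∧ b z.1 - b z.2 = 0} :=
  sum_card_fiber_mul (ZMod.castHom (by norm_num : 23 ∣ 92) (ZMod 23)).toAddMonoidHom b s

lemma fiberCount_mul {b : ZMod 92 → ZMod 3} (hb : ∀ x, x ≠ 0 → b (13 * x) = b x) (u : ZMod 23)
    (c : ZMod 3) : fiberCount b (13 * u) c = fiberCount b u c := by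
  have h85 : (85 : ZMod 92) * 13 = 1 := by decide
  have h85' : (16 : ZMod 23) * 13 = 1 := by decide
  have hinj : ∀ x y : ZMod 92, 13 * x = 13 * y → x = y := fun x y h => by
    linear_combination 85 * h - (x - y) * h85
  symm
  refine card_bij (fun x _ => 13 * x) ?_ (fun x _ y _ h => hinj x y h) ?_
  · intro x hx
    simp only [mem_filter, mem_univ, true_and] at hx ⊢
    refine ⟨⟨fun h => hx.1.1 (hinj x 0 (by rw [h, mul_zero])), ?_⟩, ?_⟩
    · rw [cast_mul_eq, hx.1.2]; rfl
    · rw [hb x hx.1.1, hx.2]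
  · intro y hy
    simp only [mem_filter, mem_univ, true_and] at hy
    have hy' : 13 * (85 * y) = y := by linear_combination y * h85
    have h0 : 85 * y ≠ 0 := fun h => hy.1.1 (by rw [← hy', h, mul_zero])
    refine ⟨85 * y, ?_, hy'⟩
    simp only [mem_filter, mem_univ, true_and]
    refine ⟨⟨h0, ?_⟩, by rw [← hb _ h0, hy', hy.2]⟩
    rw [cast_mul_eq, hy.1.2, show ((85 : ZMod 92).cast : ZMod 23) = 16 from rfl]
    linear_combination u * h85'

/-- The orbit of `u` under multiplication by `13`: zero, a square or a nonsquare. -/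
def orbitIndex (u : ZMod 23) : Fin 3 := if u = 0 then 0 else if u ^ 11 = 1 then 1 else 2

lemma fiberCount_eq {b : ZMod 92 → ZMod 3} (hb : ∀ x, x ≠ 0 → b (13 * x) = b x) (u : ZMod 23)
    (c : ZMod 3) : fiberCount b u c = fiberCount b (![0, 1, 5] (orbitIndex u)) c := by
  have hiter : ∀ (j : ℕ) (v : ZMod 23), fiberCount b (13 ^ j * v) c = fiberCount b v c := by
    intro j
    induction j with
    | zero => simp
    | succ j ih => intro v; rw [pow_succ, mul_assoc, ih, fiberCount_mul hb]
  -- 13 has order 11 modulo 23, so it generates the squares; 5 represents the nonsquares.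
  have : ∀ u : ZMod 23, ∃ j : Fin 11, u = 13 ^ (j : ℕ) * ![0, 1, 5] (orbitIndex u) := by decide
  obtain ⟨j, hj⟩ := this u
  nth_rewrite 1 [hj]
  exact hiter j _

lemma sum_orbitIndex (s : ZMod 23) (f : Fin 3 → Fin 3 → ℕ) :
    ∑ u, f (orbitIndex (u + s)) (orbitIndex u) =
      ∑ i, ∑ j, #{u | orbitIndex (u + s) = i ∧ orbitIndex u = j} * f i j := by
  rw [← sum_fiberwise univ (fun u => (orbitIndex (u + s), orbitIndex u)), Fintype.sum_prod_type]
  refine sum_congr rfl fun i _ => sum_congr rfl fun j _ => ?_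
  simp only [Prod.mk.injEq]
  rw [sum_congr rfl fun u hu => by rw [(mem_filter.1 hu).2.1, (mem_filter.1 hu).2.2], sum_const,
    smul_eq_mul]

/-- Triples of sum 4 have square sums 6, 8, 10 or 16, so 16 arises only as 6 + 10 or 8 + 8: (2,1,1)
with (3,1,0), or (2,2,0) with itself, up to order. -/
lemma four_le_sum_mul {x y : Fin 3 → ℕ} (hx : ∑ i, x i = 4) (hy : ∑ i, y i = 4)
    (h : ∑ i, x i * x i + ∑ i, y i * y i = 16) : 4 ≤ ∑ i, x i * y i := by
  simp only [Fin.sum_univ_three] at *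
  have key : ∀ a b c d : Fin 5, a.val + b.val ≤ 4 → c.val + d.val ≤ 4 →
      a.val * a.val + b.val * b.val + (4 - a.val - b.val) * (4 - a.val - b.val) +
      (c.val * c.val + d.val * d.val + (4 - c.val - d.val) * (4 - c.val - d.val)) = 16 →
      4 ≤ a.val * c.val + b.val * d.val + (4 - a.val - b.val) * (4 - c.val - d.val) := by
    decide +kernel
  have := key ⟨x 0, by lia⟩ ⟨x 1, by lia⟩ ⟨y 0, by lia⟩ ⟨y 1, by lia⟩
  have hx2 : x 2 = 4 - x 0 - x 1 := by lia
  have hy2 : y 2 = 4 - y 0 - y 1 := by lia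
  rw [hx2, hy2] at h ⊢
  exact this (by simp; lia) (by simp; lia) h

set_option linter.constructorNameAsVariable false in
lemma not_isPerfectMap_of_invariant {b : ZMod 92 → ZMod 3}
    (hinv : ∀ x, x ≠ 0 → b (13 * x) = b x) : ¬ IsPerfectMap b 30 := by
  intro hb
  have h0 := sum_fiberCount_mul b 0
  have h1 := sum_fiberCount_mul b 1
  have e0 : ({h : ZMod 92 | (h.cast : ZMod 23) = 0} : Finset (ZMod 92)) = {0, 23, 46, 69} := by
    decide
  have e1 : ({h : ZMod 92 | (h.cast : ZMod 23) = 1} : Finset (ZMod 92)) = {1, 24, 47, 70} := by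
    decide
  have hz : #{z : ZMod 92 × ZMod 92 | z.1 ≠ 0 ∧ z.2 ≠ 0 ∧ z.1 - z.2 = 0 ∧ b z.1 - b z.2 = 0} =
      91 := by
    refine (card_bij (fun z _ => z.1) ?_ ?_ fun x hx => ⟨(x, x), by simpa using hx, rfl⟩).trans
      (card_ne_zero_filter (H := ZMod 92) (n := 91) (ZMod.card _))
    · intro z hz
      simp only [mem_filter, mem_univ, true_and] at hz ⊢
      exact hz.1
    · rintro ⟨x, y⟩ hz ⟨x', y'⟩ hz' h
      simp only [mem_filter, mem_univ, true_and, sub_eq_zero] at hz hz' h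
      rw [← hz.2.2.1, ← hz'.2.2.1, h]
  have hne : ∀ h : ZMod 92, h ≠ 0 → #{z : ZMod 92 × ZMod 92 |
      z.1 ≠ 0 ∧ z.2 ≠ 0 ∧ z.1 - z.2 = h ∧ b z.1 - b z.2 = 0} = 30 := fun h hh => hb h hh 0
  have s0 : (∑ h ∈ ({0, 23, 46, 69} : Finset (ZMod 92)), #{z : ZMod 92 × ZMod 92 |
      z.1 ≠ 0 ∧ z.2 ≠ 0 ∧ z.1 - z.2 = h ∧ b z.1 - b z.2 = 0}) = 181 := by
    rw [sum_insert (by decide), hz, sum_congr rfl fun h hh =>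
      hne h (by rintro rfl; revert hh; decide), sum_const]
    rfl
  have s1 : (∑ h ∈ ({1, 24, 47, 70} : Finset (ZMod 92)), #{z : ZMod 92 × ZMod 92 |
      z.1 ≠ 0 ∧ z.2 ≠ 0 ∧ z.1 - z.2 = h ∧ b z.1 - b z.2 = 0}) = 120 := by
    rw [sum_congr rfl fun h hh => hne h (by rintro rfl; revert hh; decide), sum_const]
    rfl
  rw [e0, s0] at h0
  rw [e1, s1] at h1
  have t0 : ∑ c, fiberCount b 0 c = 3 := (sum_fiberCount b 0).trans (by decide)
  have t1 : ∑ c, fiberCount b 1 c = 4 := (sum_fiberCount b 1).trans (by decide)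
  have t5 : ∑ c, fiberCount b 5 c = 4 := (sum_fiberCount b 5).trans (by decide)
  set g : Fin 3 → Fin 3 → ℕ := fun i j =>
    ∑ c, fiberCount b (![0, 1, 5] i) c * fiberCount b (![0, 1, 5] j) c with hg
  have hsum : ∀ s : ZMod 23, ∑ u, ∑ c, fiberCount b (u + s) c * fiberCount b u c =
      ∑ i, ∑ j, #{u | orbitIndex (u + s) = i ∧ orbitIndex u = j} * g i j := by
    intro s
    rw [← sum_orbitIndex s g]
    refine sum_congr rfl fun u _ => sum_congr rfl fun c _ => ?_
    rw [fiberCount_eq hinv (u + s), fiberCount_eq hinv u]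
  have c0 : ∀ i j, #{u | orbitIndex (u + 0) = i ∧ orbitIndex u = j} =
      ![![1, 0, 0], ![0, 11, 0], ![0, 0, 11]] i j := by decide
  -- These are the cyclotomic numbers of order 2 modulo 23, bordered by the orbit of 0.
  have c1 : ∀ i j, #{u | orbitIndex (u + 1) = i ∧ orbitIndex u = j} =
      ![![0, 0, 1], ![1, 5, 5], ![0, 6, 5]] i j := by decide
  rw [hsum] at h0 h1
  simp only [c0, c1, Fin.sum_univ_three] at h0 h1
  simp at h0 h1
  have hcomm : g 2 1 = g 1 2 := sum_congr rfl fun c _ => mul_comm _ _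
  have hg0 : g 0 0 ≤ 9 := by
    have : g 0 0 ≤ (∑ c, fiberCount b 0 c) * ∑ c, fiberCount b 0 c := by
      rw [sum_mul_sum]
      exact sum_le_sum fun c _ => single_le_sum (f := fun c' => fiberCount b 0 c *
        fiberCount b 0 c') (fun _ _ => Nat.zero_le _) (mem_univ c)
    rw [t0] at this
    exact this
  -- Shift 0 gives g 0 0 + 11 (g 1 1 + g 2 2) = 181 with g 0 0 ≤ 9, forcing g 0 0 = 5. Shift 1 then
  -- fails, as 5·16 + 11·4 = 124 > 120.
  have h4 : g 1 1 + g 2 2 = 16 := by lia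
  have := four_le_sum_mul (x := fiberCount b 1) (y := fiberCount b 5) t1 t5 h4
  have h5 : 4 ≤ g 1 2 := this
  lia

lemma not_isPerfectMap_ninetyOne (b : ZMod (91 + 1) → ZMod 3) : ¬ IsPerfectMap b 30 := by
  intro hb
  have hcard : Fintype.card (ZMod (91 + 1)) = 91 + 1 := ZMod.card _
  have h7 := dvd_multiplierDefect (q := 7) (e := 10) (t := ((13 : ℕ) : ℤ)) hcard hb (by norm_num)
    (by decide) (by norm_num)
    (fun x => by
      have : ((13 : ℕ) : ZMod (91 + 1)) = 7 ^ 10 := by decide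
      simp only [zsmul_eq_mul, nsmul_eq_mul, Int.cast_natCast, this]
      push_cast; rfl)
    (fun x => by
      have : ((13 : ℕ) : ZMod 3) = 7 ^ 10 := by decide
      simp only [zsmul_eq_mul, nsmul_eq_mul, Int.cast_natCast, this]
      push_cast; rfl)
  have h13 := dvd_multiplierDefect (q := 13) (e := 1) (t := ((13 : ℕ) : ℤ)) hcard hb (by norm_num)
    (by decide) (by norm_num) (by simp) (by simp)
  obtain ⟨c, hc⟩ := exists_multiplier (d := 91) (t := ((13 : ℕ) : ℤ)) hcard (by rw [ZMod.card]) hb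
    (zsmul_bijective_of_coprime (by norm_num)) (zsmul_bijective_of_coprime (by norm_num))
    (by norm_num) (fun g => by
      have := IsCoprime.mul_dvd (by norm_num) (h7 g) (h13 g)
      exact this)
  have hc' : ∀ x : ZMod 92, x ≠ 0 → b (13 * x) = b x + c := by
    intro x hx
    have h1 := hc x hx
    simp only [zsmul_eq_mul, Int.cast_natCast] at h1
    rw [show ((13 : ℕ) : ZMod 3) = 1 from rfl, one_mul] at h1
    exact h1
  have hiter : ∀ j : ℕ, b (13 ^ j : ZMod 92) = b 1 + j * c := by
    intro j
    induction j with
    | zero => simp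
    | succ j ih =>
      have h0 : (13 : ZMod 92) ^ j ≠ 0 := by
        have hu : IsUnit (13 : ZMod 92) := IsUnit.of_mul_eq_one 85 (by decide)
        have : Fact (1 < 92) := ⟨by norm_num⟩
        exact (hu.pow j).ne_zero
      rw [pow_succ', hc' _ h0, ih]
      push_cast; ring
  have h11 := hiter 11
  rw [show (13 : ZMod 92) ^ 11 = 1 by decide, left_eq_add] at h11
  have hc0 : c = 0 := by
    have : ∀ c : ZMod 3, ((11 : ℕ) : ZMod 3) * c = 0 → c = 0 := by decide
    exact this c h11
  exact not_isPerfectMap_of_invariant (fun x hx => by rw [hc' x hx, hc0, add_zero]) hb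

end NinetyOne

end PerfectMap

theorem theorem5 (n p : ℕ)
    (hnp : (n, p) ∈ ({(63, 31), (91, 3), (92, 7), (93, 23)} : Set (ℕ × ℕ))) :
    (¬ ∃ a : ℕ → ℂ, IsAlmostPAry p (n + 1) a ∧ IsPerfectSeq (n + 1) a) ∧
    (¬ ∃ R : Finset (ZMod (n + 1) × ZMod p), IsRDS (n + 1) p n ((n - 1) / p) R) := by
  have key : p.Prime ∧ n = (n - 1) / p * p + 1 ∧
      ∀ b : ZMod (n + 1) → ZMod p, ¬ IsPerfectMap b ((n - 1) / p) := by
    simp only [Set.mem_insert_iff, Set.mem_singleton_iff, Prod.mk.injEq] at hnp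
    rcases hnp with ⟨rfl, rfl⟩ | ⟨rfl, rfl⟩ | ⟨rfl, rfl⟩ | ⟨rfl, rfl⟩
    -- In the three prime cases t is a prime factor of n exceeding l = 2, 13, 4 respectively.
    · have : Fact (Nat.Prime 31) := ⟨by norm_num⟩
      exact ⟨by norm_num, by norm_num, PerfectMap.not_isPerfectMap_of_prime (t := 7) (k := 8)
        (by norm_num) (by norm_num) (by norm_num) (by decide) (by norm_num) (by norm_num)
        (by norm_num [Nat.ModEq]) (by norm_num [Nat.ModEq])⟩
    · exact ⟨by norm_num, by norm_num, PerfectMap.not_isPerfectMap_ninetyOne⟩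
    · have : Fact (Nat.Prime 7) := ⟨by norm_num⟩
      exact ⟨by norm_num, by norm_num, PerfectMap.not_isPerfectMap_of_prime (t := 23) (k := 10)
        (by norm_num) (by norm_num) (by norm_num) (by decide) (by norm_num) (by norm_num)
        (by norm_num [Nat.ModEq]) (by norm_num [Nat.ModEq])⟩
    · have : Fact (Nat.Prime 23) := ⟨by norm_num⟩
      exact ⟨by norm_num, by norm_num, PerfectMap.not_isPerfectMap_of_prime (t := 31) (k := 46)
        (by norm_num) (by norm_num) (by norm_num) (by decide) (by norm_num) (by norm_num)
        (by norm_num [Nat.ModEq]) (by norm_num [Nat.ModEq])⟩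
  obtain ⟨hp, hl, hno⟩ := key
  have : Fact p.Prime := ⟨hp⟩
  constructor
  · rintro ⟨a, ha, hperf⟩
    obtain ⟨b, hb⟩ := PerfectMap.exists_of_sequence hl ha hperf
    exact hno b hb
  · rintro ⟨R, hR⟩
    obtain ⟨b, hb⟩ := PerfectMap.exists_of_isRDS (ZMod.card _) hR
    exact hno b hb
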